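/- Let $\mathbb F_q$ be a finite field with $q$ elements, let $n\ge 1$ be an integer, and let $P=\sum_{i=0}^m a_i\theta^i\in\mathbb F_q[\theta]$ be a polynomial of degree $m\ge 0$ with leading coefficient $a_m$. Let $\mathfrak C^n_P$ denote the twist by $P$ of the $n$-th tensor power of the Carlitz module, i.e. the rank one object over $\mathbb F_q(\theta)[T]$ on whose basis vector $\tau$ acts as multiplication by $Q=P(\theta)\,(T-\theta)^n$. For a monic irreducible polynomial $\mathfrak P\in\mathbb F_q[\theta]$ of degree $d$, let $\tilde Q\in(\mathbb F_q[\theta]/\mathfrak P)[T]$ be the reduction of $Q$, let $\tilde Q^{(i)}$ be obtained from $\tilde Q$ by raising its coefficients to the power $q^i$, and put $\tilde Q^{[d]}=\tilde Q^{(d-1)}\cdots\tilde Q^{(1)}\tilde Q$, which lies in $\mathbb F_q[T]$. The $L$-function of $\mathfrak C^n_P$ is $$L(\mathfrak C^n_P,U)=\prod_{\mathfrak P}\bigl(1-\tilde Q^{[d]}U^{d}\bigr)^{-1}\in\mathbb F_q[T][[U]],\qquad d=\deg\mathfrak P,$$ the product being over all monic irreducible $\mathfrak P\in\mathbb F_q[\theta]$.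 The analytic rank of $(P,n)$ is the order of zero of $L(\mathfrak C^n_P,U)$, as a polynomial in $U$, at $U=1$. If $m\equiv -n \pmod{q-1}$ and $a_m=(-1)^n$, then $L(\mathfrak C^n_P,U)$ is a polynomial in $U$ over $\mathbb F_q[T]$ that is divisible by $1-U$ in $\mathbb F_q[T][U]$. Consequently the analytic rank of $(P,n)$ is at least $1$. -/

import Mathlib

open Polynomial

namespace CarlitzTwist

/-- The (finite) primes of `F[θ]`: monic irreducible polynomials. -/
abbrev Prime (F : Type*) [Field F] : Type _ := {p : F[X] // p.Monic ∧ Irreducible p}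

/-- The degree of a prime. -/
noncomputable abbrev Prime.deg {F : Type*} [Field F] (p : Prime F) : ℕ := p.1.natDegree

/-- The residue field `F[θ]/𝔓`. -/
abbrev ResidueField {F : Type*} [Field F] (p : Prime F) : Type _ := AdjoinRoot p.1

instance {F : Type*} [Field F] (p : Prime F) : Fact (Irreducible p.1) := ⟨p.2.2⟩

/-- The multiplication by `τ` on the basis vector of the twist `𝔠ⁿ_P`: the element
`P(θ) (T - θ)ⁿ` of `F[θ][T]`. The inner variable is `θ`, the outer variable is `T`. -/
noncomputable def tauMatrix {F : Type*} [Field F] (P : F[X]) (n : ℕ) : F[X][X] :=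
  C P * (X - C X) ^ n

/-- Reduction `F[θ][T] → (F[θ]/𝔓)[T]` of the coefficients modulo `𝔓`. -/
noncomputable def reduction {F : Type*} [Field F] (p : Prime F) (Q : F[X][X]) :
    (ResidueField p)[X] :=
  Q.map (AdjoinRoot.mk p.1)

/-- `a^{(k)}`: raise all the coefficients of `a` to the power `q ^ k`, where `q = #F`. -/
noncomputable def frobTwist (F : Type*) [Field F] [Fintype F] {K : Type*} [Field K] [Algebra F K]
    (k : ℕ) (a : K[X]) : K[X] :=
  a.map ((FiniteField.frobeniusAlgHom F K ^ k : K →ₐ[F] K) : K →+* K)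

/-- `a^{[k]} = a^{(k-1)} ⋯ a^{(1)} a`. -/
noncomputable def frobProd (F : Type*) [Field F] [Fintype F] {K : Type*} [Field K] [Algebra F K]
    (k : ℕ) (a : K[X]) : K[X] :=
  ∏ i ∈ Finset.range k, frobTwist F i a

theorem coeff_frobTwist {F : Type*} [Field F] [Fintype F] {K : Type*} [Field K] [Algebra F K]
    (k : ℕ) (a : K[X]) (i : ℕ) :
    (frobTwist F k a).coeff i = a.coeff i ^ Fintype.card F ^ k := by
  simp [frobTwist, AlgHom.coe_pow, FiniteField.coe_frobeniusAlgHom, pow_iterate]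

/-- `a^{[d]}` has coefficients in `F` when `d` is the degree of the residue field. -/
theorem exists_descent {F : Type*} [Field F] [Fintype F] (p : Prime F)
    (a : (ResidueField p)[X]) :
    ∃ g : F[X], g.map (algebraMap F (ResidueField p)) = frobProd F p.deg a := by
  have hdeg : Module.finrank F (ResidueField p) = p.deg := finrank_quotient_span_eq_natDegree
  have : Module.Finite F (ResidueField p) := p.2.1.finite_adjoinRoot
  have : Finite (ResidueField p) := Module.finite_of_finite F
  set φ := FiniteField.frobeniusAlgHom F (ResidueField p) with hφ
  have hord : φ ^ p.deg = 1 := by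
    rw [← hdeg, ← FiniteField.orderOf_frobeniusAlgHom F (ResidueField p)]
    exact pow_orderOf_eq_one _
  have hfix : (frobProd F p.deg a).map (φ : ResidueField p →+* ResidueField p)
      = frobProd F p.deg a := by
    have hstep : ∀ i, (frobTwist F i a).map (φ : ResidueField p →+* ResidueField p)
        = frobTwist F (i + 1) a := by
      intro i
      rw [frobTwist, frobTwist, Polynomial.map_map, pow_succ']
      rfl
    have h0 : frobTwist F p.deg a = frobTwist F 0 a := by
      rw [frobTwist, frobTwist, ← hφ, hord, pow_zero]
    have hpos : 0 < p.deg := p.2.2.natDegree_pos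
    obtain ⟨d, hd⟩ := Nat.exists_eq_succ_of_ne_zero hpos.ne'
    rw [frobProd, Polynomial.map_prod, Finset.prod_congr rfl (fun i _ => hstep i)]
    rw [hd] at h0 ⊢
    rw [Finset.prod_range_succ, h0, Finset.prod_range_succ']
  have hco : ∀ n, (frobProd F p.deg a).coeff n ∈ Set.range (algebraMap F (ResidueField p)) := by
    intro n
    have hx : φ ((frobProd F p.deg a).coeff n) = (frobProd F p.deg a).coeff n := by
      conv_rhs => rw [← hfix]
      rw [Polynomial.coeff_map]
      rfl
    rw [← IntermediateField.mem_bot, IsGalois.mem_bot_iff_fixed]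
    intro σ
    obtain ⟨i, hi⟩ := (FiniteField.bijective_frobeniusAlgHom_pow F (ResidueField p)).2
      (σ : ResidueField p →ₐ[F] ResidueField p)
    have h2 : σ ((frobProd F p.deg a).coeff n) = (φ ^ i.1) ((frobProd F p.deg a).coeff n) :=
      (congrArg (fun f => f ((frobProd F p.deg a).coeff n)) hi).symm
    rw [h2, AlgHom.coe_pow]
    exact Function.iterate_fixed hx _
  exact (Polynomial.mem_lifts _).1 ((Polynomial.lifts_iff_coeff_lifts _).2 hco)

/-- The element `Q̃^{[d]}` of `F[T]`, where `Q̃` is the reduction of `Q` at `𝔓` and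
`d = deg 𝔓`. -/
noncomputable def localNorm {F : Type*} [Field F] [Fintype F] (Q : F[X][X]) (p : Prime F) : F[X] :=
  (exists_descent p (reduction p Q)).choose

theorem map_localNorm {F : Type*} [Field F] [Fintype F] (Q : F[X][X]) (p : Prime F) :
    (localNorm Q p).map (algebraMap F (ResidueField p)) = frobProd F p.deg (reduction p Q) :=
  (exists_descent p (reduction p Q)).choose_spec

/-- The local factor `(1 - Q̃^{[d]} U^d)⁻¹` in `F[T][[U]]`. -/
noncomputable def localFactor {F : Type*} [Field F] [Fintype F] (Q : F[X][X]) (p : Prime F) :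
    PowerSeries F[X] :=
  PowerSeries.invOfUnit (1 - PowerSeries.C (localNorm Q p) * PowerSeries.X ^ p.deg) 1

theorem localFactor_spec {F : Type*} [Field F] [Fintype F] (Q : F[X][X]) (p : Prime F) :
    (1 - PowerSeries.C (localNorm Q p) * PowerSeries.X ^ p.deg) * localFactor Q p = 1 := by
  have hpos : p.deg ≠ 0 := p.2.2.natDegree_pos.ne'
  exact PowerSeries.mul_invOfUnit _ _ (by simp [hpos])

theorem finite_primes (F : Type*) [Field F] [Fintype F] (N : ℕ) :
    {p : Prime F | p.deg ≤ N}.Finite := by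
  apply Set.Finite.of_finite_image (f := fun p : Prime F => fun i : Fin (N + 1) => p.1.coeff i)
  · exact Set.toFinite _
  · intro p hp r hr h
    apply Subtype.ext
    ext i
    by_cases hi : i < N + 1
    · exact congrFun h ⟨i, hi⟩
    · have hp' : p.deg ≤ N := hp
      have hr' : r.deg ≤ N := hr
      rw [coeff_eq_zero_of_natDegree_lt (show p.1.natDegree < i by lia),
        coeff_eq_zero_of_natDegree_lt (show r.1.natDegree < i by lia)]

/-- The primes of degree at most `N`. -/
noncomputable def primesUpTo (F : Type*) [Field F] [Fintype F] (N : ℕ) : Finset (Prime F) :=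
  (finite_primes F N).toFinset

/-- The infinite product `∏_𝔓 L_𝔓` in `F[T][[U]]`: a factor at a prime of degree `d` is
`1 + O(U^d)`, so the coefficient of `U^N` is that of the product over the primes of degree
at most `N` (see `coeff_prod_eq`). -/
noncomputable def eulerProduct {F : Type*} [Field F] [Fintype F] (Q : F[X][X]) :
    PowerSeries F[X] :=
  PowerSeries.mk fun N => PowerSeries.coeff N (∏ p ∈ primesUpTo F N, localFactor Q p)

/-- The coefficients of the finite partial products stabilize to those of `eulerProduct`. -/
theorem coeff_prod_eq {F : Type*} [Field F] [Fintype F] (Q : F[X][X]) (N : ℕ)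
    (s : Finset (Prime F)) (hs : primesUpTo F N ⊆ s) :
    PowerSeries.coeff N (∏ p ∈ s, localFactor Q p) = PowerSeries.coeff N (eulerProduct Q) := by
  classical
  have key : ∀ t : Finset (Prime F), (∀ p ∈ t, N < p.deg) → ∀ A : PowerSeries F[X],
      PowerSeries.coeff N (A * ∏ p ∈ t, localFactor Q p) = PowerSeries.coeff N A := by
    intro t
    induction t using Finset.induction_on with
    | empty => simp
    | insert p t hp ih =>
      intro ht A
      rw [Finset.prod_insert hp, ← mul_assoc,
        ih (fun r hr => ht r (Finset.mem_insert_of_mem hr))]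
      have h1 : A * localFactor Q p = A
          + PowerSeries.X ^ p.deg * (A * PowerSeries.C (localNorm Q p) * localFactor Q p) := by
        linear_combination A * localFactor_spec Q p
      rw [h1, map_add, PowerSeries.coeff_X_pow_mul',
        if_neg (not_le.2 (ht p (Finset.mem_insert_self p t))), add_zero]
  rw [eulerProduct, PowerSeries.coeff_mk, ← Finset.prod_sdiff hs, mul_comm]
  apply key
  intro p hp
  rw [Finset.mem_sdiff, primesUpTo, Set.Finite.mem_toFinset] at hp
  exact not_le.1 hp.2

/-- The `L`-function `L(𝔠ⁿ_P, U)` in `F[T][[U]]`. There are no bad primes, so the product is over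
all the primes of `F[θ]`. -/
noncomputable def LFunction {F : Type*} [Field F] [Fintype F] (P : F[X]) (n : ℕ) :
    PowerSeries F[X] :=
  eulerProduct (tauMatrix P n)

open Classical in
/-- The order of zero at `U = 1` of a power series `L` in `F[T][[U]]` that is a polynomial in `U`
(the value `0` is assigned if `L` is not a polynomial in `U`). -/
noncomputable def orderAtOne {F : Type*} [Field F] (L : PowerSeries F[X]) : ℕ :=
  if h : ∃ Λ : F[X][X], (Λ : PowerSeries F[X]) = L then h.choose.rootMultiplicity 1 else 0

/-- The analytic rank of the pair `(P, n)`: the order of zero of `L(𝔠ⁿ_P, U)` at `U = 1`. -/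
noncomputable def analyticRank {F : Type*} [Field F] [Fintype F] (P : F[X]) (n : ℕ) : ℕ :=
  orderAtOne (LFunction P n)

end CarlitzTwist

/-!
The `L`-function becomes explicit through reciprocity. For a prime `p` of `F[θ]` with roots `αᵢ` in
an algebraic closure `K`, the local norm of `P(θ)(T - θ)ⁿ` is `∏ P(αᵢ) · p(T)ⁿ`
(`frobProd_X_sub_C_root` identifies the conjugates of `θ mod p` with the `αᵢ`). Writing
`P = a ∏ (X - βⱼ)`, the first factor is `∏ p(βⱼ)` up to the sign `(a (-1)^m)^{deg p}`, and the
hypotheses make this sign trivial, since `(-1)^{n+m} = 1` in `F` when `q - 1 ∣ n + m`. Hence the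
local norm is the value at `p` of the completely multiplicative function `f ↦ f(T)ⁿ ∏ f(βⱼ)`, a
product of evaluations of `f` at `n + m` points of `K[T]` (`map_localNorm_tauMatrix`), and unique
factorization turns the Euler product into the series `∑ U^{deg f} f(T)ⁿ ∏ f(βⱼ)` over monic `f`
(`map_coeff_eulerProduct`).

As a function of the coefficients of `f`, the summand is a polynomial of degree at most `n + m`, so
the argument of Chevalley and Warning shows that its sum over the monic `f` of degree `N` vanishes
as soon as `(q - 1) N > n + m` (`sum_evalProd_add_eq_zero`): the series is a polynomial in `U`. For
the same reason the sum over all `f` of degree `< D` vanishes for large `D`. Since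
`q - 1 ∣ n + m`, the summand is invariant under scaling `f` by `F^×`, and it is zero at `f = 0`
because `n + m > 0`; so this sum is `-1 = q - 1` times the sum over the monic `f` of degree `< D`,
which is the value of the `L`-function at `U = 1` (`sum_range_sum_evalProd_eq_zero`).
-/

namespace CarlitzTwist

/-! ### Power sums of products of evaluations -/

section PowerSums

variable {F : Type*} [Field F] {A : Type*} [CommRing A] [Algebra F A]

/-- The polynomial of degree less than `D` with the given coefficients. -/
noncomputable def lowerTerms {D : ℕ} (x : Fin D → F) : F[X] :=
  ∑ i, C (x i) * X ^ (i : ℕ)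

/-- The monic polynomial of degree `D` with the given lower coefficients. -/
noncomputable def monicOfCoeffs {D : ℕ} (x : Fin D → F) : F[X] :=
  X ^ D + lowerTerms x

/-- The completely multiplicative function `f ↦ ∏ f(t)`, the product being over the multiset `M`
of evaluation points `t`. -/
noncomputable def evalProd (F : Type*) [Field F] {A : Type*} [CommRing A] [Algebra F A]
    (M : Multiset A) : F[X] →* A where
  toFun f := (M.map fun t => aeval t f).prod
  map_one' := by simp
  map_mul' f g := by simp [Multiset.prod_map_mul]

theorem evalProd_apply (M : Multiset A) (f : F[X]) :
    evalProd F M f = (M.map fun t => aeval t f).prod := rfl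

theorem evalProd_C (M : Multiset A) (c : F) :
    evalProd F M (C c) = algebraMap F A c ^ M.card := by
  simp [evalProd_apply]

theorem evalProd_zero {M : Multiset A} (hM : M ≠ 0) : evalProd F M 0 = 0 := by
  rw [← C_0, evalProd_C, map_zero, zero_pow (by simpa using hM)]

theorem lowerTerms_snoc {D : ℕ} (x : Fin D → F) (c : F) :
    lowerTerms (Fin.snoc x c : Fin (D + 1) → F) = lowerTerms x + C c * X ^ D := by
  simp [lowerTerms, Fin.sum_univ_castSucc]

theorem lowerTerms_smul {D : ℕ} (x : Fin D → F) (c : F) :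
    lowerTerms (c • x) = C c * lowerTerms x := by
  simp [lowerTerms, Finset.mul_sum, mul_assoc]

variable [Fintype F]

/-- The vanishing lemma behind the Chevalley–Warning theorem, for polynomials whose coefficients
lie in an algebra over the finite field. -/
theorem sum_eval_algebraMap_eq_zero {σ : Type*} [Fintype σ] [DecidableEq σ]
    (f : MvPolynomial σ A) (h : f.totalDegree < (Fintype.card F - 1) * Fintype.card σ) :
    ∑ x : σ → F, MvPolynomial.eval (fun i => algebraMap F A (x i)) f = 0 := by
  simp only [MvPolynomial.eval_eq']
  rw [Finset.sum_comm]
  refine Finset.sum_eq_zero fun d hd => ?_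
  obtain ⟨i, hi⟩ : ∃ i, d i < Fintype.card F - 1 := f.exists_degree_lt _ h hd
  have hmon : ∑ x : σ → F, ∏ j, x j ^ d j = 0 := by
    have := Finset.prod_univ_sum (fun _ : σ => (Finset.univ : Finset F)) (fun j a => a ^ d j)
    rw [Fintype.piFinset_univ] at this
    rw [← this]
    exact Finset.prod_eq_zero (Finset.mem_univ i)
      (FiniteField.sum_pow_lt_card_sub_one F (d i) hi)
  rw [← Finset.mul_sum]
  have := congrArg (algebraMap F A) hmon
  simp only [map_sum, map_prod, map_pow, map_zero] at this
  rw [this, mul_zero]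

/-- As a function of the coefficients of `f`, the product `∏ f(t)` has degree at most the number
of evaluation points, so that it sums to zero over a large affine space of polynomials. -/
theorem sum_evalProd_add_eq_zero (M : Multiset A) (g : F[X]) {D : ℕ}
    (h : M.card < (Fintype.card F - 1) * D) :
    ∑ x : Fin D → F, evalProd F M (g + lowerTerms x) = 0 := by
  let L : A → MvPolynomial (Fin D) A := fun t =>
    MvPolynomial.C (aeval t g) + ∑ i : Fin D, MvPolynomial.C (t ^ (i : ℕ)) * MvPolynomial.X i
  have hL : ∀ t, (L t).totalDegree ≤ 1 := by
    intro t
    refine (MvPolynomial.totalDegree_add _ _).trans (max_le (by simp) ?_)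
    refine MvPolynomial.totalDegree_finsetSum_le fun i _ => ?_
    refine (MvPolynomial.totalDegree_mul _ _).trans ?_
    rw [MvPolynomial.totalDegree_C, zero_add, MvPolynomial.X]
    exact (MvPolynomial.totalDegree_monomial_le _ _).trans (by simp)
  have hdeg : (M.map L).prod.totalDegree ≤ M.card := by
    refine (MvPolynomial.totalDegree_multiset_prod _).trans ?_
    rw [Multiset.map_map]
    refine (Multiset.sum_le_card_nsmul _ 1 ?_).trans (by simp)
    intro k hk
    obtain ⟨t, -, rfl⟩ := Multiset.mem_map.1 hk
    exact hL t
  rw [← sum_eval_algebraMap_eq_zero (F := F) (M.map L).prod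
    (hdeg.trans_lt (by rwa [Fintype.card_fin]))]
  refine Finset.sum_congr rfl fun x _ => ?_
  rw [evalProd_apply, map_multiset_prod, Multiset.map_map]
  refine congrArg _ (Multiset.map_congr rfl fun t _ => ?_)
  simp only [L, lowerTerms, Function.comp_apply, map_add, map_sum, map_mul, map_pow,
    MvPolynomial.eval_C, MvPolynomial.eval_X, aeval_C, aeval_X, mul_comm (t ^ _)]

/-- When `q - 1` divides the number of evaluation points, the sum of `∏ f(t)` over the polynomials
with a given degree and leading coefficient does not depend on that leading coefficient. -/
theorem sum_evalProd_leadingCoeff {M : Multiset A} (hM : Fintype.card F - 1 ∣ M.card)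
    (D : ℕ) (u : Fˣ) :
    ∑ x : Fin D → F, evalProd F M (lowerTerms x + C (u : F) * X ^ D) =
      ∑ x : Fin D → F, evalProd F M (monicOfCoeffs x) := by
  rw [← Equiv.sum_comp (MulAction.toPerm u : Equiv.Perm (Fin D → F))]
  refine Finset.sum_congr rfl fun x _ => ?_
  have h1 : lowerTerms (u • x) + C (u : F) * X ^ D = C (u : F) * monicOfCoeffs x := by
    rw [Units.smul_def, lowerTerms_smul, monicOfCoeffs]
    ring
  have h2 : (u : F) ^ M.card = 1 := by
    obtain ⟨k, hk⟩ := hM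
    rw [hk, pow_mul, FiniteField.pow_card_sub_one_eq_one _ u.ne_zero, one_pow]
  rw [MulAction.toPerm_apply, h1, map_mul, evalProd_C, ← map_pow, h2, map_one, one_mul]

theorem sum_evalProd_lowerTerms_succ {M : Multiset A} (hM : Fintype.card F - 1 ∣ M.card)
    (D : ℕ) :
    ∑ x : Fin (D + 1) → F, evalProd F M (lowerTerms x) =
      ∑ x : Fin D → F, evalProd F M (lowerTerms x) -
        ∑ x : Fin D → F, evalProd F M (monicOfCoeffs x) := by
  classical
  rw [← Equiv.sum_comp (Fin.snocEquiv fun _ : Fin (D + 1) => F), Fintype.sum_prod_type]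
  simp only [Fin.snocEquiv, Equiv.coe_fn_mk, lowerTerms_snoc]
  have hcard : ((Fintype.card Fˣ : ℕ) : A) = -1 := by
    have hF : ((Fintype.card Fˣ : ℕ) : F) = -1 := by
      rw [Fintype.card_units, Nat.cast_sub Fintype.card_pos, Nat.cast_one,
        FiniteField.cast_card_eq_zero, zero_sub]
    simpa using congrArg (algebraMap F A) hF
  rw [← Finset.add_sum_erase _ _ (Finset.mem_univ (0 : F))]
  have hunits : ∑ c ∈ Finset.univ.erase (0 : F),
      ∑ x : Fin D → F, evalProd F M (lowerTerms x + C c * X ^ D) =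
      ∑ u : Fˣ, ∑ x : Fin D → F, evalProd F M (lowerTerms x + C (u : F) * X ^ D) := by
    refine (Finset.sum_bij (fun (u : Fˣ) _ => (u : F)) (fun u _ => by simp)
      (fun u _ v _ h => Units.ext h) (fun c hc => ?_) fun _ _ => rfl).symm
    exact ⟨Units.mk0 c (Finset.ne_of_mem_erase hc), Finset.mem_univ _, rfl⟩
  rw [hunits, Finset.sum_congr rfl fun u _ => sum_evalProd_leadingCoeff hM D u,
    Finset.sum_const, Finset.card_univ, nsmul_eq_mul, hcard]
  simp [sub_eq_add_neg]

/-- The trivial zero: the sums of `∏ f(t)` over the monic polynomials of degree `0, 1, 2, …` add up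
to zero when `q - 1` divides the positive number of evaluation points. -/
theorem sum_range_sum_evalProd_eq_zero {M : Multiset A} (hM0 : M ≠ 0)
    (hM : Fintype.card F - 1 ∣ M.card) {D : ℕ} (h : M.card < (Fintype.card F - 1) * D) :
    ∑ d ∈ Finset.range D, ∑ x : Fin d → F, evalProd F M (monicOfCoeffs x) = 0 := by
  have hrec : ∀ E : ℕ, ∑ d ∈ Finset.range E, ∑ x : Fin d → F, evalProd F M (monicOfCoeffs x) =
      -∑ x : Fin E → F, evalProd F M (lowerTerms x) := by
    intro E
    induction E with
    | zero => simp [lowerTerms, evalProd_zero hM0]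
    | succ E ih => rw [Finset.sum_range_succ, ih, sum_evalProd_lowerTerms_succ hM]; ring
  have hall := sum_evalProd_add_eq_zero M (0 : F[X]) h
  simp only [zero_add] at hall
  rw [hrec, hall, neg_zero]

end PowerSums

/-! ### Expansion of the Euler product -/

section EulerProduct

variable {F : Type*} [Field F]

theorem degree_lowerTerms_lt {D : ℕ} (x : Fin D → F) : (lowerTerms x).degree < D := by
  refine (degree_sum_le _ _).trans_lt ((Finset.sup_lt_iff (WithBot.bot_lt_coe D)).2 fun i _ => ?_)
  exact (degree_C_mul_X_pow_le _ _).trans_lt (WithBot.coe_lt_coe.2 i.2)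

theorem monic_monicOfCoeffs {D : ℕ} (x : Fin D → F) : (monicOfCoeffs x).Monic :=
  monic_X_pow_add (degree_lowerTerms_lt x)

theorem natDegree_monicOfCoeffs {D : ℕ} (x : Fin D → F) : (monicOfCoeffs x).natDegree = D := by
  refine natDegree_eq_of_degree_eq_some ?_
  rw [monicOfCoeffs, degree_add_eq_left_of_degree_lt, degree_X_pow]
  rw [degree_X_pow]
  exact degree_lowerTerms_lt x

theorem coeff_monicOfCoeffs {D : ℕ} (x : Fin D → F) (i : Fin D) :
    (monicOfCoeffs x).coeff i = x i := by
  simp [monicOfCoeffs, lowerTerms, coeff_X_pow, i.2.ne, Fin.val_inj]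

theorem monicOfCoeffs_injective (D : ℕ) :
    Function.Injective (monicOfCoeffs : (Fin D → F) → F[X]) := fun x y h => by
  ext i
  rw [← coeff_monicOfCoeffs x, h, coeff_monicOfCoeffs]

theorem monicOfCoeffs_coeff {f : F[X]} (hf : f.Monic) :
    monicOfCoeffs (fun i : Fin f.natDegree => f.coeff i) = f := by
  conv_rhs => rw [hf.as_sum, ← Fin.sum_univ_eq_sum_range (fun i => C (f.coeff i) * X ^ i)]
  rfl

variable (F) [Fintype F]

/-- The monic polynomials of degree `N`. -/
noncomputable def monicsOfDegree (N : ℕ) : Finset F[X] :=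
  Finset.univ.map ⟨monicOfCoeffs (D := N), monicOfCoeffs_injective N⟩

variable {F}

theorem mem_monicsOfDegree {N : ℕ} {f : F[X]} :
    f ∈ monicsOfDegree F N ↔ f.Monic ∧ f.natDegree = N := by
  constructor
  · intro h
    obtain ⟨x, -, rfl⟩ := Finset.mem_map.1 h
    exact ⟨monic_monicOfCoeffs x, natDegree_monicOfCoeffs x⟩
  · rintro ⟨hf, rfl⟩
    exact Finset.mem_map.2 ⟨_, Finset.mem_univ _, monicOfCoeffs_coeff hf⟩

open Classical in
/-- The monic polynomials of degree `N` all of whose prime factors lie in `s`. -/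
noncomputable def smoothMonics (s : Finset (Prime F)) (N : ℕ) : Finset F[X] :=
  (monicsOfDegree F N).filter fun f => ∀ p : Prime F, p.1 ∣ f → p ∈ s

theorem mem_smoothMonics {s : Finset (Prime F)} {N : ℕ} {f : F[X]} :
    f ∈ smoothMonics s N ↔
      (f.Monic ∧ f.natDegree = N) ∧ ∀ p : Prime F, p.1 ∣ f → p ∈ s := by
  classical
  rw [smoothMonics, Finset.mem_filter, mem_monicsOfDegree]

theorem smoothMonics_primesUpTo (N : ℕ) :
    smoothMonics (primesUpTo F N) N = monicsOfDegree F N := by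
  classical
  refine Finset.filter_true_of_mem fun f hf p hp => ?_
  obtain ⟨hf1, rfl⟩ := mem_monicsOfDegree.1 hf
  rw [primesUpTo, Set.Finite.mem_toFinset]
  exact natDegree_le_of_dvd hp hf1.ne_zero

variable {A : Type*} [CommRing A] (χ : F[X] →* A)

/-- The Dirichlet series `∑ χ(f) U^{deg f}` over the monic polynomials `f` all of whose prime
factors lie in `s`. -/
noncomputable def smoothSeries (s : Finset (Prime F)) : PowerSeries A :=
  PowerSeries.mk fun N => ∑ f ∈ smoothMonics s N, χ f

theorem smoothSeries_empty : smoothSeries χ ∅ = 1 := by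
  ext N
  rw [smoothSeries, PowerSeries.coeff_mk, PowerSeries.coeff_one]
  have hone : ∀ f : F[X], f ∈ smoothMonics ∅ N → f = 1 := by
    intro f hf
    obtain ⟨⟨hf1, -⟩, hf2⟩ := mem_smoothMonics.1 hf
    by_contra hne
    obtain ⟨g, hg1, hg2, hg3⟩ := exists_monic_irreducible_factor f
      fun hu => hne (hf1.eq_one_of_isUnit hu)
    exact Finset.notMem_empty _ (hf2 ⟨g, hg1, hg2⟩ hg3)
  split_ifs with hN
  · subst hN
    have h1 : smoothMonics (∅ : Finset (Prime F)) 0 = {1} := by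
      refine Finset.eq_singleton_iff_unique_mem.2 ⟨mem_smoothMonics.2 ⟨by simp, ?_⟩, hone⟩
      intro p hp
      exact absurd (isUnit_of_dvd_one hp) p.2.2.not_isUnit
    rw [h1, Finset.sum_singleton, map_one]
  · refine Finset.sum_eq_zero fun f hf => absurd ?_ hN
    rw [← (mem_smoothMonics.1 hf).1.2, hone f hf, natDegree_one]

/-- Splitting the polynomials according to whether `p` divides them. -/
theorem smoothSeries_insert [DecidableEq (Prime F)] {s : Finset (Prime F)} {p : Prime F}
    (hp : p ∉ s) :
    (1 - PowerSeries.C (χ p.1) * PowerSeries.X ^ p.deg) * smoothSeries χ (insert p s) =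
      smoothSeries χ s := by
  classical
  rw [sub_mul, one_mul, sub_eq_iff_eq_add]
  ext N
  rw [map_add, mul_assoc, PowerSeries.coeff_C_mul, PowerSeries.coeff_X_pow_mul']
  simp only [smoothSeries, PowerSeries.coeff_mk]
  rw [← Finset.sum_filter_not_add_sum_filter _ (fun f => p.1 ∣ f)]
  congr 1
  · refine Finset.sum_congr ?_ fun _ _ => rfl
    ext f
    rw [Finset.mem_filter, mem_smoothMonics, mem_smoothMonics, and_assoc]
    refine and_congr_right fun _ => ⟨fun h r hr => ?_, fun h => ⟨fun r hr => ?_, fun hpf => ?_⟩⟩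
    · refine (Finset.mem_insert.1 (h.1 r hr)).resolve_left ?_
      rintro rfl
      exact h.2 hr
    · exact Finset.mem_insert_of_mem (h r hr)
    · exact hp (h p hpf)
  · split_ifs with hN
    · rw [Finset.mul_sum]
      refine (Finset.sum_bij (fun g _ => p.1 * g) ?_ ?_ ?_ ?_).symm
      · intro g hg
        obtain ⟨⟨hg1, hg2⟩, hg3⟩ := mem_smoothMonics.1 hg
        refine Finset.mem_filter.2 ⟨mem_smoothMonics.2 ⟨⟨p.2.1.mul hg1, ?_⟩, ?_⟩,
          dvd_mul_right _ _⟩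
        · rw [p.2.1.natDegree_mul hg1, hg2]
          exact Nat.add_sub_cancel' hN
        · intro r hr
          rcases r.2.2.prime.dvd_or_dvd hr with h | h
          · have hrp : r = p := Subtype.ext (eq_of_monic_of_associated r.2.1 p.2.1
              (r.2.2.associated_of_dvd p.2.2 h))
            exact hrp ▸ Finset.mem_insert_self p s
          · exact hg3 r h
      · intro g _ g' _ h
        exact mul_left_cancel₀ p.2.1.ne_zero h
      · intro f hf
        obtain ⟨hf1, g, rfl⟩ := Finset.mem_filter.1 hf
        obtain ⟨⟨hm, hd⟩, hs⟩ := mem_smoothMonics.1 hf1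
        have hg : g.Monic := p.2.1.of_mul_monic_left hm
        rw [p.2.1.natDegree_mul hg] at hd
        exact ⟨g, mem_smoothMonics.2 ⟨⟨hg, (Nat.sub_eq_of_eq_add' hd.symm).symm⟩,
          fun r hr => hs r (hr.mul_left _)⟩, rfl⟩
      · intro g _
        rw [map_mul]
    · rw [mul_zero]
      refine Finset.sum_eq_zero fun f hf => absurd ?_ hN
      obtain ⟨hf1, hpf⟩ := Finset.mem_filter.1 hf
      obtain ⟨⟨hm, rfl⟩, -⟩ := mem_smoothMonics.1 hf1
      exact natDegree_le_of_dvd hpf hm.ne_zero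

/-- If `φ` carries the local norms of `Q` to the values at primes of a completely multiplicative
function `χ`, then it carries the Euler product of `Q` to the Dirichlet series of `χ`. -/
theorem map_coeff_eulerProduct (Q : F[X][X]) (φ : F[X] →+* A)
    (h : ∀ p : Prime F, φ (localNorm Q p) = χ p.1) (N : ℕ) :
    φ (PowerSeries.coeff N (eulerProduct Q)) = ∑ x : Fin N → F, χ (monicOfCoeffs x) := by
  classical
  have hprod : ∀ s : Finset (Prime F),
      PowerSeries.map φ (∏ p ∈ s, localFactor Q p) = smoothSeries χ s := by
    intro s
    induction s using Finset.induction_on with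
    | empty => rw [Finset.prod_empty, map_one, smoothSeries_empty]
    | insert p s hp ih =>
      have hspec := congrArg (PowerSeries.map φ) (localFactor_spec Q p)
      rw [map_mul, map_sub, map_mul, map_pow, PowerSeries.map_C, PowerSeries.map_X, map_one, h]
        at hspec
      rw [Finset.prod_insert hp, map_mul, ih]
      linear_combination (-PowerSeries.map φ (localFactor Q p)) * smoothSeries_insert χ hp +
        smoothSeries χ (insert p s) * hspec
  rw [eulerProduct, PowerSeries.coeff_mk, ← PowerSeries.coeff_map, hprod, smoothSeries,
    PowerSeries.coeff_mk, smoothMonics_primesUpTo, monicsOfDegree, Finset.sum_map]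
  rfl

end EulerProduct

/-! ### Local norms as values at primes -/

section LocalNorm

variable {F : Type*} [Field F]

theorem reduction_tauMatrix (p : Prime F) (P : F[X]) (n : ℕ) :
    reduction p (tauMatrix P n) =
      C (aeval (AdjoinRoot.root p.1) P) * (X - C (AdjoinRoot.root p.1)) ^ n := by
  rw [reduction, tauMatrix, AdjoinRoot.aeval_eq]
  simp

variable [Fintype F]

theorem frobProd_mul {K : Type*} [Field K] [Algebra F K] (k : ℕ) (a b : K[X]) :
    frobProd F k (a * b) = frobProd F k a * frobProd F k b := by
  simp [frobProd, frobTwist, Finset.prod_mul_distrib]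

theorem frobProd_pow {K : Type*} [Field K] [Algebra F K] (k n : ℕ) (a : K[X]) :
    frobProd F k (a ^ n) = frobProd F k a ^ n := by
  simp [frobProd, frobTwist, Finset.prod_pow]

/-- The conjugates of the residue class of `θ` are the roots of the prime `p`. -/
theorem frobProd_X_sub_C_root (p : Prime F) :
    frobProd F p.deg (X - C (AdjoinRoot.root p.1)) =
      p.1.map (algebraMap F (ResidueField p)) := by
  obtain ⟨g, hg⟩ := exists_descent p (X - C (AdjoinRoot.root p.1))
  rw [← hg]
  have hfac : ∀ i, frobTwist F i (X - C (AdjoinRoot.root p.1)) =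
      X - C (((FiniteField.frobeniusAlgHom F (ResidueField p)) ^ i) (AdjoinRoot.root p.1)) := by
    intro i
    simp [frobTwist]
  have hmonic : (g.map (algebraMap F (ResidueField p))).Monic := by
    rw [hg, frobProd]
    refine monic_prod_of_monic _ _ fun i _ => ?_
    rw [hfac]
    exact monic_X_sub_C _
  have hdeg : g.natDegree = p.deg := by
    rw [← natDegree_map (algebraMap F (ResidueField p)), hg, frobProd,
      natDegree_prod_of_monic _ _ fun i _ => by rw [hfac]; exact monic_X_sub_C _]
    simp [hfac]
  have hroot : aeval (AdjoinRoot.root p.1) g = 0 := by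
    rw [aeval_def, ← eval_map, hg, frobProd, eval_prod]
    refine Finset.prod_eq_zero (Finset.mem_range.2 p.2.2.natDegree_pos) ?_
    rw [hfac]
    simp
  have hdvd : p.1 ∣ g := by
    rwa [← AdjoinRoot.mk_eq_zero, ← AdjoinRoot.aeval_eq]
  have hgm : g.Monic := monic_of_injective (algebraMap F (ResidueField p)).injective hmonic
  rw [eq_of_monic_of_dvd_of_natDegree_le p.2.1 hgm hdvd hdeg.le]

/-- The evaluation points `T` (with multiplicity `n`) and the roots of `P`. -/
noncomputable def evalPoints (K : Type*) [Field K] [Algebra F K] (P : F[X]) (n : ℕ) :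
    Multiset K[X] :=
  Multiset.replicate n X + (P.aroots K).map C

/-- The reciprocity law `Res(p, P) = ± Res(P, p)`: the sign is trivial by the assumptions on the
degree and the leading coefficient of `P`. -/
theorem map_localNorm_tauMatrix {K : Type*} [Field K] [Algebra F K] [IsAlgClosed K] {P : F[X]}
    {n : ℕ} (hlead : P.leadingCoeff * (-1) ^ P.natDegree = 1) (p : Prime F) :
    (localNorm (tauMatrix P n) p).map (algebraMap F K) =
      evalProd F (evalPoints K P n) p.1 := by
  have : Module.Finite F (ResidueField p) := p.2.1.finite_adjoinRoot
  let ι : ResidueField p →ₐ[F] K := IsAlgClosed.lift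
  -- the conjugates in `K` of the residue class of `θ`
  let α : ℕ → K := fun i =>
    ι (((FiniteField.frobeniusAlgHom F (ResidueField p)) ^ i) (AdjoinRoot.root p.1))
  have hι : (ι : ResidueField p →+* K).comp (algebraMap F (ResidueField p)) = algebraMap F K :=
    ι.comp_algebraMap
  have hp : p.1.map (algebraMap F K) = ∏ i ∈ Finset.range p.deg, (X - C (α i)) := by
    rw [← hι, ← Polynomial.map_map, ← frobProd_X_sub_C_root, frobProd, Polynomial.map_prod]
    refine Finset.prod_congr rfl fun i _ => ?_
    simp [frobTwist, α]
  have hnorm : (localNorm (tauMatrix P n) p).map (algebraMap F K) =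
      C (∏ i ∈ Finset.range p.deg, aeval (α i) P) * p.1.map (algebraMap F K) ^ n := by
    rw [← hι, ← Polynomial.map_map, map_localNorm, reduction_tauMatrix, frobProd_mul,
      frobProd_pow, frobProd_X_sub_C_root, Polynomial.map_mul, Polynomial.map_pow, Polynomial.map_map]
    congr 1
    rw [frobProd, Polynomial.map_prod, map_prod]
    refine Finset.prod_congr rfl fun i _ => ?_
    rw [frobTwist, map_C, map_C]
    congr 1
    simp only [α, aeval_algHom_apply, RingHom.coe_coe]
  have hP : ∀ x : K, aeval x P = ((P.aroots K).map fun β => β - x).prod := by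
    intro x
    have hsplit := (IsAlgClosed.splits (P.map (algebraMap F K))).eq_prod_roots
    have hcard : (P.aroots K).card = P.natDegree := by
      rw [aroots_def, ← (IsAlgClosed.splits (P.map (algebraMap F K))).natDegree_eq_card_roots,
        natDegree_map]
    have hneg : ((P.aroots K).map fun β => x - β).prod =
        (-1) ^ P.natDegree * ((P.aroots K).map fun β => β - x).prod := by
      rw [← hcard, ← Multiset.card_map (fun β => β - x), ← Multiset.prod_map_neg,
        Multiset.map_map]
      simp
    rw [aeval_def, ← eval_map, hsplit, eval_mul, eval_C, eval_multiset_prod, Multiset.map_map,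
      leadingCoeff_map]
    simp only [Function.comp_def, eval_sub, eval_X, eval_C]
    rw [← aroots_def, hneg, ← mul_assoc]
    have := congrArg (algebraMap F K) hlead
    rw [map_mul, map_pow, map_neg, map_one] at this
    rw [this, one_mul]
  have haeval : ∀ β : K, aeval (C β) p.1 = C (∏ i ∈ Finset.range p.deg, (β - α i)) := by
    intro β
    have h1 : aeval β p.1 = ∏ i ∈ Finset.range p.deg, (β - α i) := by
      rw [aeval_def, ← eval_map, hp, eval_prod]
      simp
    rw [← h1]
    exact aeval_algHom_apply (Algebra.ofId K K[X] |>.restrictScalars F) β p.1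
  have hX : aeval (X : K[X]) p.1 = p.1.map (algebraMap F K) := by
    rw [aeval_def, ← eval₂_C_X (p := p.1.map _), eval₂_map]; rfl
  rw [hnorm, evalProd_apply, evalPoints, Multiset.map_add, Multiset.prod_add,
    Multiset.map_replicate, Multiset.prod_replicate, hX, mul_comm, Multiset.map_map]
  congr 1
  simp only [Function.comp_def, haeval, hP]
  rw [← Multiset.prod_map_prod, map_multiset_prod, Multiset.map_map]
  rfl

end LocalNorm

/-! ### Polynomiality and the zero at `U = 1` -/

/-- Under the congruence on the degree and the condition on the leading coefficient, the
`L`-function is a nonzero polynomial in `U` with a root at `U = 1`. -/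
theorem exists_polynomial_eq_LFunction {F : Type*} [Field F] [Fintype F] (P : F[X]) (n : ℕ)
    (hn : 1 ≤ n) (hm : (P.natDegree : ℤ) ≡ -(n : ℤ) [ZMOD ((Fintype.card F : ℤ) - 1)])
    (hlead : P.leadingCoeff = (-1) ^ n) :
    ∃ Λ : F[X][X], (Λ : PowerSeries F[X]) = LFunction P n ∧ Λ ≠ 0 ∧ Λ.IsRoot 1 := by
  let K := AlgebraicClosure F
  let φ : F[X] →+* K[X] := mapRingHom (algebraMap F K)
  have hφ : Function.Injective φ := map_injective _ (algebraMap F K).injective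
  let M : Multiset K[X] := evalPoints K P n
  have hMcard : M.card = n + P.natDegree := by
    simp only [M, evalPoints, Multiset.card_add, Multiset.card_replicate, Multiset.card_map]
    rw [aroots_def, ← (IsAlgClosed.splits (P.map (algebraMap F K))).natDegree_eq_card_roots,
      natDegree_map]
  have hM0 : M ≠ 0 := by
    rw [← Multiset.card_pos, hMcard]
    lia
  have hq : 1 < Fintype.card F := Fintype.one_lt_card
  have hdvd : Fintype.card F - 1 ∣ n + P.natDegree := by
    rw [← Int.natCast_dvd_natCast, Nat.cast_sub hq.le]
    have := hm.symm.dvd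
    rwa [sub_neg_eq_add, add_comm, ← Nat.cast_add] at this
  -- `-1` has order dividing `q - 1`, hence `(-1) ^ (n + m) = 1`
  have hsign : P.leadingCoeff * (-1) ^ P.natDegree = 1 := by
    obtain ⟨k, hk⟩ := hdvd
    rw [hlead, ← pow_add, hk, pow_mul,
      FiniteField.pow_card_sub_one_eq_one _ (neg_ne_zero.2 one_ne_zero), one_pow]
  have hcoeff : ∀ N, φ (PowerSeries.coeff N (LFunction P n)) =
      ∑ x : Fin N → F, evalProd F M (monicOfCoeffs x) :=
    map_coeff_eulerProduct (evalProd F M) (tauMatrix P n) φ (map_localNorm_tauMatrix hsign)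
  let D := M.card + 1
  have hbound : ∀ N, D ≤ N → M.card < (Fintype.card F - 1) * N := fun N hN =>
    (Nat.lt_of_succ_le hN).trans_le (Nat.le_mul_of_pos_left N (Nat.sub_pos_of_lt hq))
  have hvanish : ∀ N, D ≤ N → PowerSeries.coeff N (LFunction P n) = 0 := by
    intro N hN
    refine hφ ?_
    rw [hcoeff, map_zero]
    exact sum_evalProd_add_eq_zero M (X ^ N) (hbound N hN)
  let Λ : F[X][X] := PowerSeries.trunc D (LFunction P n)
  have hΛ : (Λ : PowerSeries F[X]) = LFunction P n := by
    ext1 N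
    rw [coeff_coe, PowerSeries.coeff_trunc]
    split_ifs with hN
    · rfl
    · exact (hvanish N (not_lt.1 hN)).symm
  have hroot : Λ.IsRoot 1 := by
    refine hφ ?_
    have heval : Λ.eval 1 = ∑ d ∈ Finset.range D, PowerSeries.coeff d (LFunction P n) := by
      rw [eval, PowerSeries.eval₂_trunc_eq_sum_range]
      simp
    rw [heval, map_sum, map_zero, Finset.sum_congr rfl fun d _ => hcoeff d]
    exact sum_range_sum_evalProd_eq_zero hM0 (hMcard ▸ hdvd) (hbound D le_rfl)
  have hΛ0 : Λ ≠ 0 := by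
    have h1 : Λ.coeff 0 = 1 := by
      refine hφ ?_
      rw [← coeff_coe, hΛ, hcoeff, map_one]
      simp [monicOfCoeffs, lowerTerms]
    intro h
    rw [h, coeff_zero] at h1
    exact zero_ne_one h1
  exact ⟨Λ, hΛ, hΛ0, hroot⟩

end CarlitzTwist

/-- In `F[X][X]` below the inner variable is `T` and the outer variable is `U`. -/
theorem proposition4p2 {F : Type*} [Field F] [Fintype F] (P : F[X]) (n : ℕ) (hn : 1 ≤ n)
    (hm : (P.natDegree : ℤ) ≡ -(n : ℤ) [ZMOD ((Fintype.card F : ℤ) - 1)])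
    (hlead : P.leadingCoeff = (-1) ^ n) :
    (∃ Λ : F[X][X], (Λ : PowerSeries F[X]) = CarlitzTwist.LFunction P n ∧
        (1 - Polynomial.X) ∣ Λ) ∧
      1 ≤ CarlitzTwist.analyticRank P n := by
  obtain ⟨Λ, hΛ, hΛ0, hroot⟩ := CarlitzTwist.exists_polynomial_eq_LFunction P n hn hm hlead
  refine ⟨⟨Λ, hΛ, ?_⟩, ?_⟩
  · rw [← neg_dvd, neg_sub, ← C_1]
    exact dvd_iff_isRoot.2 hroot
  · have hex : ∃ Λ : F[X][X], (Λ : PowerSeries F[X]) = CarlitzTwist.LFunction P n := ⟨Λ, hΛ⟩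
    rw [CarlitzTwist.analyticRank, CarlitzTwist.orderAtOne, dif_pos hex,
      show hex.choose = Λ from coe_inj.1 (hex.choose_spec.trans hΛ.symm)]
    exact (rootMultiplicity_pos hΛ0).2 hroot
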